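/- Let $G$ be a group, and write $[x,y]=x^{-1}y^{-1}xy$ and $x^y=y^{-1}xy$ for $x,y\in G$. Put $[x,_0\,g]=x$ and $[x,_{n}\,g]=[[x,_{n-1}\,g],g]$ for $n\ge 1$, and call $x\in G$ a right $4$-Engel element of $G$ if $[x,_4\,g]=1$ for all $g\in G$. If $a\in G$ is any element, and $b\in G$ is such that both $b$ and $b^{-1}$ are right $4$-Engel elements of $G$, then the subgroup $\langle a,a^b\rangle$ of $G$ is nilpotent of class at most $4$. -/

import Mathlib

/-- The iterated (`n`-Engel) commutator `[a,_n b]`, with `[a,_0 b] = a` and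
`[a,_{n+1} b] = [[a,_n b], b]`, where `[x, y] = x⁻¹ y⁻¹ x y`. -/
def engelCommutator {G : Type*} [Group G] (a b : G) : ℕ → G
  | 0 => a
  | n + 1 => (engelCommutator a b n)⁻¹ * b⁻¹ * engelCommutator a b n * b

/-- The set `R_n(G)` of right `n`-Engel elements of `G`: those `x` with `[x,_n g] = 1` for
all `g` in `G`. -/
def rightEngel (n : ℕ) (G : Type*) [Group G] : Set G :=
  {x | ∀ g : G, engelCommutator x g n = 1}

section CommutatorCalculus

variable {G : Type*} [Group G]

/-! Put `x = a^b`. Since `[b, a] = (x⁻¹) a`, the relation `[b,_4 a] = 1` is a conjugate of `[x⁻¹,_3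
a] = 1`. Applying this to `b` with `a^{±1}`, and to `b⁻¹` with `x^{±1}`, leaves four 3-Engel
relations in the two generators `a`, `x`. With `k = a x a⁻¹ x⁻¹`, `c = [k, a]`, `f = [k, x]`, these
say that `c` commutes with `a`, `k` and `f` with `x`, `k` (`commute_of_engelCommutator_three`). The
crux, `commute_of_commutator_relations`, is that then `[c, x] = [f, a]` is central. Hence `c`, `f`
lie in the second centre, `k` in the third, and `a`, `x` in the fourth. -/

theorem SemiconjBy.eq_of_eq {a p q r s : G} (hp : SemiconjBy a p r) (hq : SemiconjBy a q s)
    (h : r = s) : p = q := by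
  have h₁ : a * p = a * q := by rw [hp.eq, hq.eq, h]
  exact mul_left_cancel h₁

theorem SemiconjBy.commute_of_commute {a p q r s : G} (hp : SemiconjBy a p r)
    (hq : SemiconjBy a q s) (h : Commute r s) : Commute p q :=
  (hp.mul_right hq).eq_of_eq (hq.mul_right hp) h

/-- Suppose `k = a x a⁻¹ x⁻¹` commutes with `c = [k, a]` and `f = [k, x]`, that `c` commutes with
`a` and that `f` commutes with `x`. Then `c` commutes with `f`, and `c⁻¹ c ^ x = f⁻¹ f ^ a`
commutes with `a` and `x`. -/
theorem commute_of_commutator_relations {a x k c f d g : G} (hk : a * x = k * x * a)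
    (hka : SemiconjBy a (k * c) k) (hkx : SemiconjBy x (k * f) k) (hcx : SemiconjBy x d c)
    (hfa : SemiconjBy a g f) (hkc : Commute k c) (hkf : Commute k f) (hac : Commute a c)
    (hxf : Commute x f) :
    c⁻¹ * d = f⁻¹ * g ∧ Commute a (c⁻¹ * d) ∧ Commute x (c⁻¹ * d) := by
  -- Conjugating by `a` the commutation of `f` with `x` and `k` shows that `g` commutes with `x`;
  -- symmetrically `d` commutes with `a`.
  have hx₁ : SemiconjBy a ((k * c)⁻¹ * x) x := by
    have h := hka.inv_right.eq
    rw [SemiconjBy, ← mul_assoc, h, mul_assoc, hk]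
    group
  have hgx₁ : Commute ((k * c)⁻¹ * x) g := hx₁.commute_of_commute hfa hxf
  have hgkc : Commute (k * c) g := hka.commute_of_commute hfa hkf
  have hxg : Commute x g := by
    have h := hgkc.mul_left hgx₁
    rwa [mul_inv_cancel_left] at h
  have hxa : SemiconjBy x (k * f * a) a := by
    rw [SemiconjBy, hk, ← hkx.eq, mul_assoc x]
  have hkfd : Commute (k * f) d := hkx.commute_of_commute hcx hkc
  have had : Commute a d := by
    have h := hkfd.inv_left.mul_left (hxa.commute_of_commute hcx hac)
    rwa [inv_mul_cancel_left] at h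
  -- This is `k x = x k f` conjugated by `a`. It gives `(k c)^x = k c g`, to be compared with `(k
  -- c)^x = k f d`.
  have hkcx : SemiconjBy x (k * c * g) (k * c) := by
    have h := (hx₁.mul_right (hka.mul_right hfa)).eq_of_eq (hka.mul_right hx₁)
      (by rw [hkx.eq])
    rw [SemiconjBy]
    calc x * (k * c * g) = k * c * ((k * c)⁻¹ * x * (k * c * g)) := by group
      _ = k * c * x := by rw [h]; group
  have hcgfd : c * g = f * d := by
    have h := hkcx.eq_of_eq (hkx.mul_right hcx) rfl
    simpa [mul_assoc] using h
  have hgcdf : g * c = d * f := by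
    have h : g * (k * c) = d * (k * f) := by
      rw [← hgkc.eq, ← hkfd.eq, mul_assoc, hcgfd, mul_assoc]
    rw [hkc.eq, hkf.eq, ← mul_assoc, ← mul_assoc] at h
    exact mul_right_cancel h
  have hg₁ : g = c⁻¹ * f * d := by rw [mul_assoc, ← hcgfd]; group
  have hg₂ : g = d * f * c⁻¹ := by rw [← hgcdf]; group
  -- Conjugate `c⁻¹ f d = d f c⁻¹` by `a`, which fixes `c` and `d` and takes `f` to `g`.
  have hgdc : g * d * c = c * d * g := by
    have h := ((hac.inv_right.semiconjBy.mul_right hfa).mul_right had.semiconjBy).eq_of_eq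
      ((had.semiconjBy.mul_right hfa).mul_right hac.inv_right.semiconjBy)
      (hg₁.symm.trans hg₂)
    calc g * d * c = c * (c⁻¹ * g * d) * c := by group
      _ = c * d * g := by rw [h]; group
  have hak : a⁻¹ * k⁻¹ = c⁻¹ * k⁻¹ * a⁻¹ := by
    have h := congrArg (·⁻¹) hka.eq
    simpa [mul_assoc] using h.symm
  have hga : g * a⁻¹ = a⁻¹ * f := by
    rw [eq_inv_mul_iff_mul_eq, ← mul_assoc, hfa.eq, mul_inv_cancel_right]
  -- `hgxc` and `hfax` both evaluate `x k⁻¹ a⁻¹`; combining them eliminates `k` and leads to `hdcd`.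
  have hgxc : g * a⁻¹ * x * c = x * k⁻¹ * a⁻¹ := by
    have hfx : f * x = k * x * k⁻¹ := by
      rw [eq_mul_inv_iff_mul_eq, ← hkx.eq, hkf.eq, ← mul_assoc, hxf.eq]
    have hakx : a⁻¹ * k * x = x * a⁻¹ := by
      rw [eq_mul_inv_iff_mul_eq, mul_assoc, mul_assoc, ← mul_assoc k, ← hk, inv_mul_cancel_left]
    calc g * a⁻¹ * x * c = a⁻¹ * (f * x) * c := by rw [hga]; group
      _ = a⁻¹ * k * x * (k⁻¹ * c) := by rw [hfx]; group
      _ = x * (a⁻¹ * c) * k⁻¹ := by rw [hakx, hkc.inv_left.eq]; group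
      _ = x * c * (a⁻¹ * k⁻¹) := by rw [hac.inv_left.eq]; group
      _ = x * k⁻¹ * a⁻¹ := by rw [hak]; group
  have hfax : f * a⁻¹ * x = x * k⁻¹ * a⁻¹ * d⁻¹ := by
    have hax : a⁻¹ * x = x * (k * f * a)⁻¹ := by
      rw [eq_mul_inv_iff_mul_eq, mul_assoc, hxa.eq, inv_mul_cancel_left]
    have hag : a⁻¹ * f⁻¹ = g⁻¹ * a⁻¹ := by
      rw [← mul_inv_rev, ← mul_inv_rev, hfa.eq]
    calc f * a⁻¹ * x = f * (a⁻¹ * x) := mul_assoc _ _ _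
      _ = f * x * (a⁻¹ * f⁻¹) * k⁻¹ := by rw [hax]; group
      _ = x * f * g⁻¹ * (a⁻¹ * k⁻¹) := by rw [hag, hxf.eq]; group
      _ = x * f * (c * g)⁻¹ * k⁻¹ * a⁻¹ := by rw [hak]; group
      _ = x * f * (d⁻¹ * (k * f)⁻¹) * a⁻¹ := by rw [hcgfd]; group
      _ = x * k⁻¹ * (d⁻¹ * a⁻¹) := by rw [← hkfd.inv_inv.eq]; group
      _ = x * k⁻¹ * a⁻¹ * d⁻¹ := by rw [← had.inv_inv.eq]; group
  have hdcd : d * c * d⁻¹ = g⁻¹ * c * g := by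
    have haf : a * f = d⁻¹ * f * c * a := by
      calc a * f = d⁻¹ * (d * a) * f := by group
        _ = d⁻¹ * (a * (d * f * c⁻¹)) * c := by rw [← had.eq]; group
        _ = d⁻¹ * f * (a * c) := by rw [← hg₂, hfa.eq]; group
        _ = d⁻¹ * f * c * a := by rw [hac.eq]; group
    have hxcd : x * (c * d⁻¹) = x * (d⁻¹ * g⁻¹ * (f * d)) := by
      calc x * (c * d⁻¹) = a * g⁻¹ * (g * a⁻¹ * x * c) * d⁻¹ := by group
        _ = a * g⁻¹ * (x * k⁻¹ * a⁻¹ * d⁻¹) := by rw [hgxc]; group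
        _ = a * (a⁻¹ * f * a)⁻¹ * f * a⁻¹ * x := by rw [← hfax, ← hga]; group
        _ = f⁻¹ * (a * f) * a⁻¹ * x := by group
        _ = (d * f)⁻¹ * f * (c * x) := by rw [haf]; group
        _ = c⁻¹ * g⁻¹ * f * x * d := by rw [← hgcdf, ← hcx.eq]; group
        _ = c⁻¹ * x * g⁻¹ * f * d := by
          rw [mul_assoc _ f x, ← hxf.eq, ← mul_assoc, mul_assoc _ g⁻¹ x, ← hxg.inv_right.eq,
            ← mul_assoc]
        _ = x * (d⁻¹ * g⁻¹ * (f * d)) := by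
          rw [← hcx.inv_right.eq]
          group
    calc d * c * d⁻¹ = d * (c * d⁻¹) := mul_assoc _ _ _
      _ = g⁻¹ * c * g := by rw [mul_left_cancel hxcd, ← hcgfd]; group
  have hdg : Commute d g := by
    have h : c * (d * g) = c * (g * d) := by
      rw [← mul_assoc, ← hgdc]
      calc g * d * c = g * (d * c * d⁻¹) * d := by group
        _ = c * (g * d) := by rw [hdcd]; group
    exact mul_left_cancel h
  have hcf : Commute c f := by
    have h : d * (c⁻¹ * f) = d * (f * c⁻¹) := by
      calc d * (c⁻¹ * f) = d * (c⁻¹ * f * d) * d⁻¹ := by group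
        _ = g := by rw [← hg₁, hdg.eq, mul_inv_cancel_right]
        _ = d * (f * c⁻¹) := by rw [hg₂, mul_assoc]
    exact Commute.inv_left_iff.mp (mul_left_cancel h)
  have hcd : c⁻¹ * d = f⁻¹ * g := by
    rw [hg₁, hcf.inv_left.eq]
    group
  refine ⟨hcd, hac.inv_right.mul_right had, ?_⟩
  rw [hcd]
  exact hxf.inv_right.mul_right hxg

end CommutatorCalculus

section EngelRelations

variable {G : Type*} [Group G]

theorem engelCommutator_conj_inv_eq_one {a b : G} (h : engelCommutator b a 4 = 1) :
    engelCommutator (b⁻¹ * a⁻¹ * b) a 3 = 1 := by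
  have key : engelCommutator b a 4 = a⁻¹ * engelCommutator (b⁻¹ * a⁻¹ * b) a 3 * a := by
    simp only [engelCommutator]
    group
  rw [h, eq_comm] at key
  simpa [mul_assoc, inv_mul_eq_one] using key

/-- `[x⁻¹,_2 a] = c^a`, so the first relation makes `c` commute with `a`. Then `[x,_2 a⁻¹]` is `c⁻¹`
conjugated by `k x`; undoing this conjugation turns `a` into `a k⁻¹`, so `c` commutes with `a k⁻¹`
and hence with `k`. -/
theorem commute_of_engelCommutator_three {a x : G} (h : engelCommutator x⁻¹ a 3 = 1)
    (h' : engelCommutator x a⁻¹ 3 = 1) {k c : G} (hk : k = a * x * a⁻¹ * x⁻¹)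
    (hc : c = k⁻¹ * a⁻¹ * k * a) : Commute a c ∧ Commute k c := by
  have hc₂ : engelCommutator x⁻¹ a 2 = a⁻¹ * c * a := by
    simp only [engelCommutator, hc, hk]
    group
  have hac : Commute a c := by
    have h₁ : c⁻¹ * a⁻¹ * c * a = 1 := by
      have h₂ : (a⁻¹ * c * a)⁻¹ * a⁻¹ * (a⁻¹ * c * a) * a = 1 := hc₂ ▸ h
      calc c⁻¹ * a⁻¹ * c * a
          = a * ((a⁻¹ * c * a)⁻¹ * a⁻¹ * (a⁻¹ * c * a) * a) * a⁻¹ := by group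
        _ = 1 := by rw [h₂]; group
    rw [← mul_inv_rev, mul_assoc, inv_mul_eq_one] at h₁
    exact h₁
  refine ⟨hac, ?_⟩
  have he : engelCommutator x a⁻¹ 2 = x⁻¹ * k⁻¹ * c⁻¹ * k * x := by
    have hkc : k⁻¹ * a * k * a⁻¹ = c⁻¹ := by
      calc k⁻¹ * a * k * a⁻¹ = a * c⁻¹ * a⁻¹ := by rw [hc]; group
        _ = c⁻¹ := by rw [hac.inv_right.eq, mul_inv_cancel_right]
    rw [← hkc]
    simp only [engelCommutator, hk]
    group
  have hae : Commute a (x⁻¹ * k⁻¹ * c⁻¹ * k * x) := by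
    have h₁ : (x⁻¹ * k⁻¹ * c⁻¹ * k * x)⁻¹ * a⁻¹⁻¹ * (x⁻¹ * k⁻¹ * c⁻¹ * k * x) * a⁻¹ = 1 :=
      he ▸ h'
    rw [inv_inv, mul_inv_eq_one, mul_assoc, inv_mul_eq_iff_eq_mul] at h₁
    exact h₁
  have hx : SemiconjBy (k * x) a (a * k⁻¹) := by
    rw [SemiconjBy, hk]
    group
  have hx' : SemiconjBy (k * x) (x⁻¹ * k⁻¹ * c⁻¹ * k * x) c⁻¹ := by
    rw [SemiconjBy]
    group
  have hakc : Commute (a * k⁻¹) c⁻¹ := by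
    have h₁ : SemiconjBy (k * x)⁻¹ (a * k⁻¹) a := hx.inv_symm_left
    exact h₁.commute_of_commute hx'.inv_symm_left hae
  have h₁ := hac.inv_left.mul_left (Commute.inv_right_iff.mp hakc)
  rw [inv_mul_cancel_left] at h₁
  exact Commute.inv_left_iff.mp h₁

end EngelRelations

section Nilpotency

variable {G : Type*} [Group G]

/-- Membership in the upper central series may be tested on generators. -/
theorem mem_upperCentralSeries_succ_of_closure_eq_top {s : Set G} (hs : Subgroup.closure s = ⊤)
    {n : ℕ} {y : G} (h : ∀ t ∈ s, ∃ w ∈ Subgroup.upperCentralSeries G n, y * t = t * y * w) :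
    y ∈ Subgroup.upperCentralSeries G (n + 1) := by
  let π := QuotientGroup.mk' (Subgroup.upperCentralSeries G n)
  have hle : Subgroup.closure s ≤ (Subgroup.centralizer {π y}).comap π := by
    rw [Subgroup.closure_le]
    intro t ht
    obtain ⟨w, hw, hyt⟩ := h t ht
    have hπw : π w = 1 := (QuotientGroup.eq_one_iff w).mpr hw
    have hπ := congrArg π hyt
    rw [map_mul, map_mul, map_mul, hπw, mul_one] at hπ
    simpa [Subgroup.mem_centralizer_singleton_iff] using hπ.symm
  rw [Subgroup.mem_upperCentralSeries_succ_iff]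
  intro t
  have ht : t ∈ (Subgroup.centralizer {π y}).comap π := hle (hs ▸ Subgroup.mem_top t)
  rw [Subgroup.mem_comap, Subgroup.mem_centralizer_singleton_iff] at ht
  rw [← QuotientGroup.eq_one_iff]
  refine (map_commutatorElement π y t).trans ?_
  rw [ commutatorElement_eq_one_iff_mul_comm, ht]

theorem upperCentralSeries_four_eq_top {a x : G} (hgen : Subgroup.closure {a, x} = ⊤)
    (h₁ : engelCommutator x⁻¹ a 3 = 1) (h₂ : engelCommutator x a⁻¹ 3 = 1)
    (h₃ : engelCommutator a⁻¹ x 3 = 1) (h₄ : engelCommutator a x⁻¹ 3 = 1) :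
    Subgroup.upperCentralSeries G 4 = ⊤ := by
  obtain ⟨k, hk⟩ : ∃ k, k = a * x * a⁻¹ * x⁻¹ := ⟨_, rfl⟩
  obtain ⟨c, hc⟩ : ∃ c, c = k⁻¹ * a⁻¹ * k * a := ⟨_, rfl⟩
  obtain ⟨f, hf⟩ : ∃ f, f = k⁻¹ * x⁻¹ * k * x := ⟨_, rfl⟩
  obtain ⟨hac, hkc⟩ := commute_of_engelCommutator_three h₁ h₂ hk hc
  obtain ⟨hxf, hkf⟩ : Commute x f ∧ Commute k f := by
    -- Exchanging `a` and `x` inverts `k`, and `f` is a conjugate by `k` of `[k⁻¹, x]⁻¹`.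
    obtain ⟨hx, hk'⟩ := commute_of_engelCommutator_three h₃ h₄
      (k := k⁻¹) (by rw [hk]; group) rfl
    have hf' : f = k⁻¹ * (k⁻¹⁻¹ * x⁻¹ * k⁻¹ * x)⁻¹ * k := by rw [hf]; group
    have hk'' := (Commute.inv_left_iff.mp hk').inv_right
    rw [hk''.inv_left.eq, inv_mul_cancel_right] at hf'
    rw [hf']
    exact ⟨hx.inv_right, hk''⟩
  have hax : a * x = k * x * a := by rw [hk]; group
  have hka : k * a = a * k * c := by rw [hc]; group
  have hkx : k * x = x * k * f := by rw [hf]; group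
  obtain ⟨hz, haz, hxz⟩ := commute_of_commutator_relations (d := x⁻¹ * c * x) (g := a⁻¹ * f * a)
    hax (by rw [SemiconjBy, hka, mul_assoc]) (by rw [SemiconjBy, hkx, mul_assoc])
    (by rw [SemiconjBy]; group) (by rw [SemiconjBy]; group) hkc hkf hac hxf
  have mem {n : ℕ} {y : G} (u v : G) (hu : u ∈ Subgroup.upperCentralSeries G n)
      (hv : v ∈ Subgroup.upperCentralSeries G n) (hya : y * a = a * y * u)
      (hyx : y * x = x * y * v) :
      y ∈ Subgroup.upperCentralSeries G (n + 1) := by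
    refine mem_upperCentralSeries_succ_of_closure_eq_top hgen ?_
    rintro t (rfl | rfl)
    exacts [⟨u, hu, hya⟩, ⟨v, hv, hyx⟩]
  have hz₁ : c⁻¹ * (x⁻¹ * c * x) ∈ Subgroup.upperCentralSeries G 1 :=
    mem 1 1 (one_mem _) (one_mem _) (by rw [haz.eq, mul_one]) (by rw [hxz.eq, mul_one])
  have hc₂ : c ∈ Subgroup.upperCentralSeries G 2 :=
    mem 1 _ (one_mem _) hz₁ (by rw [hac.eq, mul_one]) (by group)
  have hf₂ : f ∈ Subgroup.upperCentralSeries G 2 :=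
    mem _ 1 hz₁ (one_mem _) (by rw [hz]; group) (by rw [hxf.eq, mul_one])
  have hk₃ : k ∈ Subgroup.upperCentralSeries G 3 := mem c f hc₂ hf₂ hka hkx
  have normal : (Subgroup.upperCentralSeries G 3).Normal := inferInstance
  -- `[a, x]` and `[x, a]` are conjugates of `k` and `k⁻¹`.
  have ha₄ : a ∈ Subgroup.upperCentralSeries G 4 := by
    refine mem 1 ((x * a)⁻¹ * k * (x * a)) (one_mem _) ?_ (mul_one _).symm (by rw [hax]; group)
    simpa using normal.conj_mem k hk₃ (x * a)⁻¹
  have hx₄ : x ∈ Subgroup.upperCentralSeries G 4 := by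
    refine mem ((a * x)⁻¹ * k⁻¹ * (a * x)) 1 ?_ (one_mem _) ?_ (mul_one _).symm
    · simpa using normal.conj_mem k⁻¹ (inv_mem hk₃) (a * x)⁻¹
    · calc x * a = k⁻¹ * (k * x * a) := by group
        _ = a * x * ((a * x)⁻¹ * k⁻¹ * (a * x)) := by rw [← hax]; group
  rw [eq_top_iff, ← hgen, Subgroup.closure_le]
  rintro t (rfl | rfl)
  exacts [ha₄, hx₄]

theorem map_engelCommutator {H : Type*} [Group H] (φ : G →* H) (a b : G) (n : ℕ) :
    φ (engelCommutator a b n) = engelCommutator (φ a) (φ b) n := by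
  induction n with
  | zero => rfl
  | succ n ih => simp [engelCommutator, ih]

end Nilpotency

theorem theorem1p4 {G : Type*} [Group G] (a b : G)
    (hb : b ∈ rightEngel 4 G) (hb' : b⁻¹ ∈ rightEngel 4 G) :
    Group.IsNilpotent (Subgroup.closure ({a, b⁻¹ * a * b} : Set G)) ∧
      Group.nilpotencyClass (Subgroup.closure ({a, b⁻¹ * a * b} : Set G)) ≤ 4 := by
  obtain ⟨x, hx⟩ : ∃ x, x = b⁻¹ * a * b := ⟨_, rfl⟩
  rw [← hx]
  have h₁ : engelCommutator x⁻¹ a 3 = 1 := by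
    simpa [hx, mul_assoc] using engelCommutator_conj_inv_eq_one (hb a)
  have h₂ : engelCommutator x a⁻¹ 3 = 1 := by
    simpa [hx] using engelCommutator_conj_inv_eq_one (hb a⁻¹)
  -- Conjugating `x` by `b⁻¹` returns `a`, so the roles of `a` and `x` are exchanged.
  have h₃ : engelCommutator a⁻¹ x 3 = 1 := by
    simpa [hx, mul_assoc] using engelCommutator_conj_inv_eq_one (hb' x)
  have h₄ : engelCommutator a x⁻¹ 3 = 1 := by
    simpa [hx, mul_assoc] using engelCommutator_conj_inv_eq_one (hb' x⁻¹)
  let H := Subgroup.closure ({a, x} : Set G)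
  let a' : H := ⟨a, Subgroup.subset_closure (by simp)⟩
  let x' : H := ⟨x, Subgroup.subset_closure (by simp)⟩
  have hgen : Subgroup.closure {a', x'} = ⊤ := by
    have hpre : ({a', x'} : Set H) = Subtype.val ⁻¹' {a, x} := by
      ext t
      simp [a', x', Subtype.ext_iff]
    rw [hpre]
    exact Subgroup.closure_closure_coe_preimage
  have engel {u v : H} (h : engelCommutator (u : G) v 3 = 1) : engelCommutator u v 3 = 1 :=
    Subtype.ext ((map_engelCommutator H.subtype u v 3).trans h)
  have htop : Subgroup.upperCentralSeries H 4 = ⊤ :=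
    upperCentralSeries_four_eq_top (a := a') (x := x') hgen (engel h₁) (engel h₂) (engel h₃)
      (engel h₄)
  have hnil : Group.IsNilpotent H := ⟨4, htop⟩
  exact ⟨hnil, Subgroup.upperCentralSeries_eq_top_iff_nilpotencyClass_le.mp htop⟩
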